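/- Single-sample OSO (Online Sampling Optimization) can do unboundedly better than the myopic policy. Setting. In online resource allocation, items $t=1,\dots,T$ arrive one at a time with i.i.d. parameters $\xi^t=(r^t,A^t)\sim\mathcal D$. Each item must irrevocably be rejected or assigned to one supply node $j$; the assignment yields reward $r^t_j$ and consumes $A^t_{jk}$ units of each resource $k$, whose total capacity is $b_k$. The value $\mathrm{OPT}$ is the optimal total reward when all items are known in advance. In each period $t$, single-sample OSO observes $\xi^t$, draws one fresh sample path of future items, independently from $\mathcal D$, solves to optimality the offline integer program made of item $t$ and the sampled items with the remaining capacities, implements its decision on item $t$, and discards the rest. The myopic policy chooses in each period a decision that maximizes the immediate reward subject to the remaining capacities. The integer programs are solved by a (possibly randomized) solver that always returns an optimal solution. The solver used by OSO is equivariant: permuting the items permutes the (law of the) returned solution accordingly; fresh, independent solver randomness is used in each period. Example. For $0<\varphi<1$ and $T\ge1$, let $I_{\varphi,T}$ be the instance with one supply node, one resource of capacity $\sqrt T$, and $T$ items of size $1$ with i.i.d. values equal to $1$ with probability $1/\sqrt T$ and to $\varphi$ with probability $1-1/\sqrt T$. Let $\mathrm{OSO}$ and $\mathrm{Myo}$ denote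 the total rewards of single-sample OSO and of the myopic policy on $I_{\varphi,T}$. Then: 1. (Unbounded benefit.) For every $M\in\mathbb R$ there is $\varphi_0\in(0,1]$ such that for every $\varphi\in(0,\varphi_0)$ there is $T_0$ such that for all $T\ge T_0$, whatever the solvers used, $\mathbb E[\mathrm{Myo}]>0$ and $\mathbb E[\mathrm{OSO}]\ge M\cdot\mathbb E[\mathrm{Myo}]$. 2. (OSO.) For every $\varepsilon>0$ there is $T_0$ such that for all $T\ge T_0$, all $\varphi\in(0,1)$ and every equivariant solver, $\mathbb E[\mathrm{OSO}]\ge(1-\varepsilon)\,\mathbb E[\mathrm{OPT}]$. 3. (Optimum.) For every $\varphi\in(0,1)$, $\mathbb E[\mathrm{OPT}]/\sqrt T\to1$ as $T\to\infty$. 4. (Myopic policy.) For every $\varphi\in(0,1)$ and every $T$, whatever the solver, $\mathbb E[\mathrm{Myo}]=\lfloor\sqrt T\rfloor\left(1\cdot\tfrac1{\sqrt T}+\varphi\left(1-\tfrac1{\sqrt T}\right)\right)$, which is $\varphi\sqrt T+1-\varphi$ if $T$ is a perfect square; and $\mathbb E[\mathrm{Myo}]/\mathbb E[\mathrm{OPT}]\to\varphi$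 as $T\to\infty$. -/

import Mathlib

open scoped NNReal ENNReal

namespace OnlineAllocation

noncomputable section

/-- The parameters `ξ = (r, A)` of one demand item, for supply nodes `J` and resources `K`:
assigning the item to supply node `j` yields `reward j` and consumes `size j k` units of
resource `k`. -/
@[ext]
structure Item (J K : Type) where
  /-- the rewards `r j` -/
  reward : J → ℝ
  /-- the resource requirements `A j k` -/
  size : J → K → ℝ

section Offline

variable {J K : Type}

/-- Reward of a decision about one item. A decision is an element of `Option J`: `some j` assigns
the item to supply node `j`, and `none` rejects it. (These are exactly the binary vectors
`x : J → {0, 1}` with `∑ j, x j ≤ 1`.) -/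
def Item.gain (a : Item J K) : Option J → ℝ
  | none => 0
  | some j => a.reward j

/-- Resource consumption of a decision about one item. -/
def Item.consumption (a : Item J K) : Option J → K → ℝ
  | none => fun _ => 0
  | some j => a.size j

/-- The decisions `x` about the items `a 0, …, a (n - 1)` respect the resource capacities `b`. -/
def Feasible {n : ℕ} (a : Fin n → Item J K) (b : K → ℝ) (x : Fin n → Option J) : Prop :=
  ∀ k, ∑ i, (a i).consumption (x i) k ≤ b k

/-- Total reward of the decisions `x` about the items `a 0, …, a (n - 1)`. -/
def planReward {n : ℕ} (a : Fin n → Item J K) (x : Fin n → Option J) : ℝ :=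
  ∑ i, (a i).gain (x i)

/-- `x` is an optimal solution of the offline integer program with items `a` and capacities `b`. -/
def IsOptimal {n : ℕ} (a : Fin n → Item J K) (b : K → ℝ) (x : Fin n → Option J) : Prop :=
  Feasible a b x ∧ ∀ y, Feasible a b y → planReward a y ≤ planReward a x

/-- The optimal value of the offline integer program (a maximum over finitely many plans,
attained whenever some plan is feasible). -/
def offlineOpt {n : ℕ} (a : Fin n → Item J K) (b : K → ℝ) : ℝ :=
  sSup {v | ∃ x, Feasible a b x ∧ planReward a x = v}

end Offline

/-- A (possibly randomized) integer program solver: given the items and the capacities of an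
offline integer program, it returns a random plan which is always an optimal solution if the
program is feasible. The randomness only serves to choose among several optimal solutions. -/
structure Solver (J K : Type) where
  /-- the law of the returned plan -/
  solve : (n : ℕ) → (Fin n → Item J K) → (K → ℝ) → PMF (Fin n → Option J)
  optimal : ∀ (n : ℕ) (a : Fin n → Item J K) (b : K → ℝ), (∃ x, Feasible a b x) →
    ∀ x ∈ (solve n a b).support, IsOptimal a b x

/-- A solver is equivariant if permuting the items permutes its (random) solution in the same
way. -/
def Solver.Equivariant {J K : Type} (σ : Solver J K) : Prop :=
  ∀ (n : ℕ) (a : Fin n → Item J K) (b : K → ℝ) (π : Equiv.Perm (Fin n)),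
    σ.solve n (a ∘ π) b = (σ.solve n a b).map (fun x => x ∘ π)

/-- A uniformly random optimal solution is the output of an equivariant solver; so such solvers
exist. -/
theorem exists_equivariant_solver (J K : Type) [Finite J] :
    ∃ σ : Solver J K, σ.Equivariant := by
  classical
  have _ := Fintype.ofFinite J
  let S : (n : ℕ) → (Fin n → Item J K) → (K → ℝ) → Finset (Fin n → Option J) :=
    fun n a b => Finset.univ.filter fun x => IsOptimal a b x
  have hS : ∀ n a b x, x ∈ S n a b ↔ IsOptimal a b x := fun n a b x => by simp [S]
  have hne : ∀ n a b, (∃ x, Feasible a b x) → (S n a b).Nonempty := by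
    rintro n a b ⟨x, hx⟩
    obtain ⟨y, hy, hmax⟩ := Finset.exists_max_image
      (Finset.univ.filter fun x => Feasible a b x) (planReward a) ⟨x, by simpa using hx⟩
    refine ⟨y, (hS _ _ _ _).2 ⟨by simpa using hy, fun z hz => hmax z (by simpa using hz)⟩⟩
  let f : (n : ℕ) → (Fin n → Item J K) → (K → ℝ) → PMF (Fin n → Option J) := fun n a b =>
    if h : (S n a b).Nonempty then PMF.uniformOfFinset (S n a b) h
    else PMF.pure fun _ => none
  refine ⟨⟨f, fun n a b hx x hxs => ?_⟩, fun n a b π => ?_⟩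
  · simp only [f, dif_pos (hne n a b hx)] at hxs
    rw [PMF.mem_support_uniformOfFinset_iff] at hxs
    exact (hS _ _ _ _).1 hxs
  · have hfe : ∀ x : Fin n → Option J, Feasible (a ∘ π) b (x ∘ π) ↔ Feasible a b x := fun x =>
      forall_congr' fun k => by
        simp only [Function.comp_apply]
        rw [Equiv.sum_comp π fun i => (a i).consumption (x i) k]
    have hre : ∀ x : Fin n → Option J, planReward (a ∘ π) (x ∘ π) = planReward a x := fun x =>
      Equiv.sum_comp π fun i => (a i).gain (x i)
    have hop : ∀ x : Fin n → Option J, IsOptimal (a ∘ π) b (x ∘ π) ↔ IsOptimal a b x := by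
      intro x
      unfold IsOptimal
      rw [hfe, hre]
      refine and_congr_right fun _ => ⟨fun h y hy => ?_, fun h y hy => ?_⟩
      · rw [← hre y]
        exact h _ ((hfe y).2 hy)
      · have e : y = (y ∘ π.symm) ∘ π := by ext; simp
        rw [e] at hy ⊢
        rw [hre]
        exact h _ ((hfe _).1 hy)
    have hmem : ∀ x : Fin n → Option J, x ∘ π ∈ S n (a ∘ π) b ↔ x ∈ S n a b := fun x => by
      rw [hS, hS, hop]
    have himg : S n (a ∘ π) b = (S n a b).image fun x => x ∘ π := by
      ext y
      have e : y = (y ∘ π.symm) ∘ π := by ext; simp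
      rw [Finset.mem_image]
      refine ⟨fun hy => ⟨y ∘ π.symm, ?_, e.symm⟩, ?_⟩
      · rw [e] at hy
        exact (hmem _).1 hy
      · rintro ⟨x, hx, rfl⟩
        exact (hmem x).2 hx
    have hinj : Function.Injective fun x : Fin n → Option J => x ∘ π := fun x y h =>
      π.surjective.injective_comp_right h
    have hcard : (S n (a ∘ π) b).card = (S n a b).card := by
      rw [himg, Finset.card_image_of_injective _ hinj]
    change f n (a ∘ π) b = (f n a b).map fun x => x ∘ π
    by_cases h : (S n a b).Nonempty
    · have h' : (S n (a ∘ π) b).Nonempty := by rw [himg]; exact h.image _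
      simp only [f, dif_pos h, dif_pos h']
      ext y
      have e : y = (y ∘ π.symm) ∘ π := by ext; simp
      rw [PMF.map_apply, tsum_eq_single (y ∘ π.symm)]
      · rw [if_pos e, PMF.uniformOfFinset_apply, PMF.uniformOfFinset_apply, hcard]
        have := hmem (y ∘ π.symm)
        rw [← e] at this
        by_cases hy : y ∘ π.symm ∈ S n a b
        · rw [if_pos hy, if_pos (this.2 hy)]
        · rw [if_neg hy, if_neg (mt this.1 hy)]
      · intro x hx
        rw [if_neg]
        rintro rfl
        exact hx (by ext; simp)
    · have h' : ¬ (S n (a ∘ π) b).Nonempty := by rw [himg]; simpa using h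
      simp only [f, dif_neg h, dif_neg h', PMF.pure_map]
      rfl

/-- The law of `n` independent samples from `D`. -/
def iid {α : Type} (D : PMF α) : (n : ℕ) → PMF (Fin n → α)
  | 0 => PMF.pure Fin.elim0
  | n + 1 => D.bind fun a => (iid D n).bind fun s => PMF.pure (Fin.cons a s)

/-- The mean of a discrete law on `ℝ`. -/
def mean (p : PMF ℝ) : ℝ := ∫ v, v ∂p.toMeasure

/-- A (possibly randomized) online policy. Its arguments are the number of periods that follow the
current one, the remaining capacities, i.e. the initial ones minus what the past decisions have
consumed, and the observed current item; it returns the law of the current decision. -/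
abbrev Policy (J K : Type) := ℕ → (K → ℝ) → Item J K → PMF (Option J)

/-- Single-sample OSO: draw one fresh sample path of the future items, solve the offline problem
made of the current item (at index `0`) and of the sampled items with the remaining capacities,
implement the decision about the current item, and discard the rest. -/
def oso {J K : Type} (σ : Solver J K) (D : PMF (Item J K)) : Policy J K := fun m b ξ =>
  (iid D m).bind fun s => (σ.solve (m + 1) (Fin.cons ξ s) b).map fun x => x 0

/-- The myopic policy: optimize the immediate decision only, subject to the remaining
capacities. -/
def myopic {J K : Type} (σ : Solver J K) : Policy J K := fun _ b ξ =>
  (σ.solve 1 (fun _ => ξ) b).map fun x => x 0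

/-- An instance of online resource allocation with supply nodes `J` and resources `K`: items
arrive one at a time, and their parameters are independent draws from a discrete law. -/
structure Problem (J K : Type) where
  /-- the number of periods `T` -/
  horizon : ℕ
  /-- the law `𝓓` of one item -/
  law : PMF (Item J K)
  /-- the capacities of the resources -/
  capacity : K → ℝ

/-- The law of the total reward that a policy collects during `n` remaining periods with remaining
capacities `b`: in each period an item is drawn, the policy decides about it, its consumption is
deducted from the capacities. -/
def rewardLaw {J K : Type} (D : PMF (Item J K)) (P : Policy J K) : ℕ → (K → ℝ) → PMF ℝ
  | 0, _ => PMF.pure 0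
  | m + 1, b => D.bind fun ξ => (P m b ξ).bind fun x =>
      (rewardLaw D P m (fun k => b k - ξ.consumption x k)).map fun v => ξ.gain x + v

namespace Problem

variable {J K : Type} (I : Problem J K)

/-- Expected total reward of single-sample OSO. -/
def expectedOSO (σ : Solver J K) : ℝ :=
  mean (rewardLaw I.law (oso σ I.law) I.horizon I.capacity)

/-- Expected total reward of the myopic policy. -/
def expectedMyopic (σ : Solver J K) : ℝ :=
  mean (rewardLaw I.law (myopic σ) I.horizon I.capacity)

/-- Expected perfect-information (hindsight) optimum. -/
def expectedOPT : ℝ :=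
  mean ((iid I.law I.horizon).map fun a => offlineOpt a I.capacity)

end Problem

/-- The item of value `r` and size `1`, with one supply node and one resource. -/
def unitItem (r : ℝ) : Item Unit Unit where
  reward _ := r
  size _ _ := 1

/-- The number `1 / √T` is at most one (for `T = 0` it is `0`). -/
theorem one_div_sqrt_le_one (T : ℕ) : 1 / NNReal.sqrt (T : ℝ≥0) ≤ 1 := by
  rcases Nat.eq_zero_or_pos T with rfl | h
  · simp
  · have h1 : (1 : ℝ≥0) ≤ NNReal.sqrt (T : ℝ≥0) := by
      rw [← NNReal.sqrt_one]
      exact NNReal.sqrt_le_sqrt.mpr (by exact_mod_cast h)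
    exact div_le_one_of_le₀ h1 zero_le

/-- The law on two outcomes which gives `true` the probability `p` and `false` the probability
`1 - p`. -/
def coin (p : ℝ≥0) (hp : p ≤ 1) : PMF Bool :=
  PMF.ofFintype (fun c => cond c (p : ℝ≥0∞) (1 - p : ℝ≥0)) (by
    rw [Fintype.sum_bool]
    simp only [cond_true, cond_false]
    rw [← ENNReal.coe_add, add_tsub_cancel_of_le hp, ENNReal.coe_one])

/-- The example: one supply node, one resource of capacity `√T`, and `T` items of size `1` whose
values are independently `1` with probability `1 / √T` and `φ` with probability `1 - 1 / √T`. -/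
def example₁ (φ : ℝ) (T : ℕ) : Problem Unit Unit where
  horizon := T
  law := (coin (1 / NNReal.sqrt (T : ℝ≥0)) (one_div_sqrt_le_one T)).map
    fun c => unitItem (cond c 1 φ)
  capacity _ := Real.sqrt T

end

end OnlineAllocation

/-!
With `m` periods to go and capacity `c`, let `W(m, c) = E[min(N, c)]`, where `N` is the number of
items of value `1` among `m` items; its marginal value in `c` is `P(N ≥ c)`. Measured against `W`,
one period of OSO loses at most `p P(reject a 1) P(N < c)` by rejecting an item of value `1` and at
most `P(accept a φ) P(N ≥ c)` by accepting an item of value `φ`.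

By optimality, an item of value `1` is rejected only if the sample has `N' ≥ c` further ones, and an
item of value `φ` is accepted only if `N' < c`, where `N'` is an independent copy of `N`. So each
loss involves opposite events for `N` and `N'`. By equivariance the decision is uniform among the
tied items, so its probability is at most the gap `|N - N'|` divided by their number. As
`E|N - mp| ≤ √(mp)`, each loss is at most a constant times `√(mp) / m`; for an accepted `φ` with
`2c > m`, where few items may be tied, this follows from Markov's inequality `P(N ≥ c) ≤ mp / c`.

Summing over the periods gives a regret `O(√(Tp))`. In the example `p = 1 / √T`, so the regret is
`O(T^(1/4))` while the optimum is `√T - O(T^(1/4))`. The myopic policy spends its capacity on the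
first `⌊√T⌋` items, whatever their values.
-/

namespace OnlineAllocation

open MeasureTheory
open scoped Finset

section Expectation

variable {α β : Type*} [Fintype α] [Fintype β]

/-- The expectation of a real function under a law on a finite type, as a finite sum: no
integrability conditions arise. -/
noncomputable def expect (p : PMF α) (g : α → ℝ) : ℝ := ∑ a, (p a).toReal * g a

theorem sum_toReal_eq_one (p : PMF α) : ∑ a, (p a).toReal = 1 := by
  have htotal := p.tsum_coe
  rw [tsum_fintype] at htotal
  rw [← ENNReal.toReal_sum fun a _ => p.apply_ne_top a, htotal, ENNReal.toReal_one]

theorem expect_const (p : PMF α) (r : ℝ) : expect p (fun _ => r) = r := by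
  rw [expect, ← Finset.sum_mul, sum_toReal_eq_one, one_mul]

theorem expect_add (p : PMF α) (f g : α → ℝ) :
    expect p (fun a => f a + g a) = expect p f + expect p g := by
  simp only [expect, mul_add, Finset.sum_add_distrib]

theorem expect_sub (p : PMF α) (f g : α → ℝ) :
    expect p (fun a => f a - g a) = expect p f - expect p g := by
  simp only [expect, mul_sub, Finset.sum_sub_distrib]

theorem expect_const_mul (p : PMF α) (r : ℝ) (f : α → ℝ) :
    expect p (fun a => r * f a) = r * expect p f := by
  simp only [expect, Finset.mul_sum, mul_left_comm]

theorem expect_sum {ι : Type*} (s : Finset ι) (p : PMF α) (f : ι → α → ℝ) :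
    expect p (fun a => ∑ i ∈ s, f i a) = ∑ i ∈ s, expect p (f i) := by
  simp only [expect, Finset.mul_sum]
  exact Finset.sum_comm

theorem expect_mono_support (p : PMF α) {f g : α → ℝ} (h : ∀ a ∈ p.support, f a ≤ g a) :
    expect p f ≤ expect p g := by
  refine Finset.sum_le_sum fun a _ => ?_
  by_cases ha : p a = 0
  · simp [ha]
  · exact mul_le_mul_of_nonneg_left (h a ((p.mem_support_iff a).2 ha)) ENNReal.toReal_nonneg

theorem expect_mono (p : PMF α) {f g : α → ℝ} (h : ∀ a, f a ≤ g a) :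
    expect p f ≤ expect p g :=
  expect_mono_support p fun a _ => h a

theorem expect_nonneg (p : PMF α) {f : α → ℝ} (h : ∀ a, 0 ≤ f a) : 0 ≤ expect p f :=
  Finset.sum_nonneg fun a _ => mul_nonneg ENNReal.toReal_nonneg (h a)

theorem le_expect_of_support (p : PMF α) {f : α → ℝ} {r : ℝ} (h : ∀ a ∈ p.support, r ≤ f a) :
    r ≤ expect p f :=
  (expect_const p r).ge.trans (expect_mono_support p h)

theorem expect_le_of_support (p : PMF α) {f : α → ℝ} {r : ℝ} (h : ∀ a ∈ p.support, f a ≤ r) :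
    expect p f ≤ r :=
  (expect_mono_support p h).trans (expect_const p r).le

theorem expect_eq_of_support (p : PMF α) {f : α → ℝ} {r : ℝ} (h : ∀ a ∈ p.support, f a = r) :
    expect p f = r :=
  le_antisymm (expect_le_of_support p fun a ha => (h a ha).le)
    (le_expect_of_support p fun a ha => (h a ha).ge)

theorem expect_pure (a : α) (g : α → ℝ) : expect (PMF.pure a) g = g a :=
  expect_eq_of_support _ fun b hb => by rw [(PMF.mem_support_pure_iff a b).1 hb]

theorem toReal_bind_apply {γ : Type*} (p : PMF α) (f : α → PMF γ) (c : γ) :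
    (p.bind f c).toReal = expect p fun a => (f a c).toReal := by
  rw [PMF.bind_apply, tsum_fintype, ENNReal.toReal_sum fun a _ =>
    ENNReal.mul_ne_top (p.apply_ne_top a) ((f a).apply_ne_top c)]
  simp only [ENNReal.toReal_mul, expect]

theorem expect_bind (p : PMF α) (f : α → PMF β) (g : β → ℝ) :
    expect (p.bind f) g = expect p fun a => expect (f a) g := by
  simp only [expect, toReal_bind_apply, Finset.sum_mul, Finset.mul_sum, mul_assoc]
  exact Finset.sum_comm

theorem expect_abs_le_sqrt (p : PMF α) (f : α → ℝ) :
    expect p (fun a => |f a|) ≤ √(expect p fun a => f a ^ 2) := by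
  refine Real.le_sqrt_of_sq_le ?_
  set μ := expect p fun a => |f a|
  have hvar : 0 ≤ expect p fun a => (|f a| - μ) ^ 2 := expect_nonneg p fun a => sq_nonneg _
  have hexpand : ∀ a, (|f a| - μ) ^ 2 = f a ^ 2 - 2 * μ * |f a| + μ ^ 2 := fun a => by
    rw [sub_sq, sq_abs]
    ring
  simp only [hexpand, expect_add, expect_sub, expect_const_mul, expect_const] at hvar
  linarith

theorem expect_mul_expect_le (p : PMF α) (q : PMF β) {f h : α → ℝ} {g k : β → ℝ}
    (h_le : ∀ a b, f a * g b ≤ h a + k b) : expect p f * expect q g ≤ expect p h + expect q k := by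
  calc expect p f * expect q g = expect p fun a => expect q fun b => f a * g b := by
        simp only [expect_const_mul, mul_comm _ (expect q g)]
    _ ≤ expect p fun a => expect q fun b => h a + k b :=
        expect_mono p fun a => expect_mono q fun b => h_le a b
    _ = expect p h + expect q k := by simp only [expect_add, expect_const]

end Expectation

section Mean

variable {α : Type*} [Fintype α]

/-- A discrete law on `ℝ` has a finite mean. Without this, `mean` takes the junk value `0`. -/
def HasFiniteMean (p : PMF ℝ) : Prop := Integrable (fun v => v) p.toMeasure

theorem hasFiniteMean_pure (r : ℝ) : HasFiniteMean (PMF.pure r) := by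
  rw [HasFiniteMean, PMF.toMeasure_pure]
  exact integrable_dirac (by simp)

theorem mean_pure (r : ℝ) : mean (PMF.pure r) = r := by
  rw [mean, PMF.toMeasure_pure, integral_dirac]

theorem toMeasure_bind_eq_sum {β : Type*} [MeasurableSpace β] (p : PMF α) (f : α → PMF β) :
    (p.bind f).toMeasure = ∑ a, p a • (f a).toMeasure := by
  ext s hs
  rw [PMF.toMeasure_bind_apply _ _ _ hs, tsum_fintype, Measure.finsetSum_apply]
  rfl

theorem hasFiniteMean_bind {α : Type*} [Finite α] (p : PMF α) {f : α → PMF ℝ}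
    (hf : ∀ a, HasFiniteMean (f a)) : HasFiniteMean (p.bind f) := by
  have := Fintype.ofFinite α
  rw [HasFiniteMean, toMeasure_bind_eq_sum]
  exact integrable_finsetSum_measure.2 fun a _ => (hf a).smul_measure (p.apply_ne_top a)

theorem mean_bind (p : PMF α) {f : α → PMF ℝ} (hf : ∀ a, HasFiniteMean (f a)) :
    mean (p.bind f) = expect p fun a => mean (f a) := by
  rw [mean, toMeasure_bind_eq_sum, integral_finsetSum_measure fun a _ =>
    Integrable.smul_measure (hf a) (p.apply_ne_top a)]
  simp only [integral_smul_measure, smul_eq_mul, expect, mean]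

theorem mean_map (p : PMF α) (g : α → ℝ) : mean (p.map g) = expect p g := by
  rw [PMF.map, mean_bind]
  · simp only [Function.comp_apply, mean_pure]
  · exact fun a => hasFiniteMean_pure _

theorem HasFiniteMean.map_const_add {q : PMF ℝ} (hq : HasFiniteMean q) (r : ℝ) :
    HasFiniteMean (q.map fun v => r + v) := by
  rw [HasFiniteMean, ← PMF.toMeasure_map q (f := fun v => r + v) (by fun_prop),
    integrable_map_measure (by fun_prop) (by fun_prop)]
  exact (integrable_const r).add hq

theorem HasFiniteMean.mean_map_const_add {q : PMF ℝ} (hq : HasFiniteMean q) (r : ℝ) :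
    mean (q.map fun v => r + v) = r + mean q := by
  rw [mean, ← PMF.toMeasure_map q (f := fun v => r + v) (by fun_prop),
    integral_map (by fun_prop) (by fun_prop), integral_add (integrable_const r) hq]
  simp [mean]

end Mean

section Value

variable {ι J K : Type}

/-- The expected total reward that a policy collects during `m` remaining periods with remaining
capacities `b`. -/
noncomputable def policyValue (D : PMF (Item J K)) (P : Policy J K) (m : ℕ) (b : K → ℝ) : ℝ :=
  mean (rewardLaw D P m b)

theorem policyValue_zero (D : PMF (Item J K)) (P : Policy J K) (b : K → ℝ) :
    policyValue D P 0 b = 0 :=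
  mean_pure 0

theorem hasFiniteMean_rewardLaw [Finite ι] [Finite J] (q : PMF ι) (a : ι → Item J K)
    (P : Policy J K) (m : ℕ) (b : K → ℝ) : HasFiniteMean (rewardLaw (q.map a) P m b) := by
  induction m generalizing b with
  | zero => exact hasFiniteMean_pure 0
  | succ m ih =>
    rw [rewardLaw, PMF.bind_map]
    exact hasFiniteMean_bind q fun _ => hasFiniteMean_bind _ fun _ => (ih _).map_const_add _

theorem policyValue_succ [Fintype ι] [Fintype J] (q : PMF ι) (a : ι → Item J K) (P : Policy J K)
    (m : ℕ) (b : K → ℝ) :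
    policyValue (q.map a) P (m + 1) b =
      expect q fun c => expect (P m b (a c)) fun x =>
        (a c).gain x + policyValue (q.map a) P m fun k => b k - (a c).consumption x k := by
  have hfin := hasFiniteMean_rewardLaw q a P m
  rw [policyValue, rewardLaw, PMF.bind_map]
  refine (mean_bind q fun _ =>
    hasFiniteMean_bind _ fun _ => (hfin _).map_const_add _).trans ?_
  simp only [mean_bind _ fun _ => (hfin _).map_const_add _,
    (hfin _).mean_map_const_add, policyValue]

end Value

section Iid

theorem iid_map {α β : Type} (D : PMF α) (f : α → β) (n : ℕ) :
    iid (D.map f) n = (iid D n).map fun s => f ∘ s := by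
  induction n with
  | zero =>
    rw [iid, iid, PMF.pure_map]
    exact congrArg _ (Subsingleton.elim _ _)
  | succ n ih =>
    simp only [iid, ih, PMF.map_bind, PMF.bind_map, PMF.pure_map, Function.comp_def]
    congr! 5 with a s
    exact funext fun i => Fin.cases rfl (fun _ => rfl) i

variable {α : Type} [Fintype α] (D : PMF α)

theorem expect_iid_zero (g : (Fin 0 → α) → ℝ) : expect (iid D 0) g = g Fin.elim0 :=
  expect_pure _ _

theorem expect_iid_succ (m : ℕ) (g : (Fin (m + 1) → α) → ℝ) :
    expect (iid D (m + 1)) g = expect D fun a => expect (iid D m) fun s => g (Fin.cons a s) := by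
  simp only [iid, expect_bind, expect_pure]

end Iid

section NumTrue

/-- The number of successes in a sequence of trials. -/
def numTrue {n : ℕ} (t : Fin n → Bool) : ℕ := #{i | t i = true}

theorem numTrue_le {n : ℕ} (t : Fin n → Bool) : numTrue t ≤ n :=
  (Finset.card_le_univ _).trans_eq (Fintype.card_fin n)

theorem numTrue_cons_true {n : ℕ} (s : Fin n → Bool) :
    numTrue (Fin.cons true s : Fin (n + 1) → Bool) = numTrue s + 1 := by
  simp only [numTrue, Finset.card_filter, Fin.sum_univ_succ, Fin.cons_zero, Fin.cons_succ, if_true,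
    add_comm]

theorem numTrue_cons_false {n : ℕ} (s : Fin n → Bool) :
    numTrue (Fin.cons false s : Fin (n + 1) → Bool) = numTrue s := by
  simp only [numTrue, Finset.card_filter, Fin.sum_univ_succ, Fin.cons_zero, Fin.cons_succ,
    Bool.false_eq_true, if_false, zero_add]

variable (p : ℝ≥0) (hp : p ≤ 1)

theorem expect_coin (g : Bool → ℝ) :
    expect (coin p hp) g = p * g true + (1 - p) * g false := by
  simp [expect, coin, PMF.ofFintype_apply, ENNReal.toReal_sub_of_le, hp]

theorem expect_iid_coin_succ (m : ℕ) (g : (Fin (m + 1) → Bool) → ℝ) :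
    expect (iid (coin p hp) (m + 1)) g =
      p * expect (iid (coin p hp) m) (fun s => g (Fin.cons true s)) +
        (1 - p) * expect (iid (coin p hp) m) fun s => g (Fin.cons false s) := by
  rw [expect_iid_succ, expect_coin]

theorem expect_numTrue (m : ℕ) :
    expect (iid (coin p hp) m) (fun s => (numTrue s : ℝ)) = m * p := by
  induction m with
  | zero => simp [expect_iid_zero, numTrue]
  | succ m ih =>
    simp only [expect_iid_coin_succ, numTrue_cons_true, numTrue_cons_false, Nat.cast_add_one,
      expect_add, expect_const, ih]
    ring

theorem expect_sq_numTrue_sub (m : ℕ) :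
    expect (iid (coin p hp) m) (fun s => ((numTrue s : ℝ) - m * p) ^ 2) = m * p * (1 - p) := by
  induction m with
  | zero => simp [expect_iid_zero, numTrue]
  | succ m ih =>
    have htrue : ∀ s : Fin m → Bool, ((numTrue s : ℝ) + 1 - (m + 1) * p) ^ 2 =
        (1 - p) ^ 2 + 2 * (1 - p) * (numTrue s - m * p) + (numTrue s - m * p) ^ 2 := fun s => by
      ring
    have hfalse : ∀ s : Fin m → Bool, ((numTrue s : ℝ) - (m + 1) * p) ^ 2 =
        p ^ 2 - 2 * p * (numTrue s - m * p) + (numTrue s - m * p) ^ 2 := fun s => by ring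
    simp only [expect_iid_coin_succ, numTrue_cons_true, numTrue_cons_false, Nat.cast_add_one,
      htrue, hfalse, expect_add, expect_sub, expect_const_mul, expect_const, expect_numTrue, ih]
    ring

theorem expect_abs_numTrue_sub_le (m : ℕ) :
    expect (iid (coin p hp) m) (fun s => |(numTrue s : ℝ) - m * p|) ≤ √(m * p) := by
  refine (expect_abs_le_sqrt _ _).trans (Real.sqrt_le_sqrt ?_)
  rw [expect_sq_numTrue_sub]
  exact mul_le_of_le_one_right (by positivity) (sub_le_self 1 p.2)

end NumTrue

section UnitItems

variable {n : ℕ} {r : Fin n → ℝ} {b : Unit → ℝ} {x : Fin n → Option Unit}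

/-- The set of items that a plan accepts. -/
def accepted (x : Fin n → Option Unit) : Finset (Fin n) := {i | x i = some ()}

/-- The plan that accepts exactly the items in a given set. -/
def acceptPlan (S : Finset (Fin n)) : Fin n → Option Unit :=
  fun i => if i ∈ S then some () else none

theorem mem_accepted {i : Fin n} : i ∈ accepted x ↔ x i = some () := by simp [accepted]

theorem accepted_acceptPlan (S : Finset (Fin n)) : accepted (acceptPlan S) = S := by
  ext i
  simp [mem_accepted, acceptPlan]

theorem unitItem_gain (v : ℝ) (d : Option Unit) :
    (unitItem v).gain d = if d = some () then v else 0 := by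
  cases d <;> simp [Item.gain, unitItem]

theorem unitItem_consumption (v : ℝ) (d : Option Unit) (k : Unit) :
    (unitItem v).consumption d k = if d = some () then 1 else 0 := by
  cases d <;> simp [Item.consumption, unitItem]

theorem feasible_unitItem_iff :
    Feasible (fun i => unitItem (r i)) b x ↔ (#(accepted x) : ℝ) ≤ b () := by
  simp only [Feasible, unitItem_consumption, accepted, Finset.sum_boole]
  exact ⟨fun h => h (), fun h _ => h⟩

theorem planReward_unitItem (r : Fin n → ℝ) (x : Fin n → Option Unit) :
    planReward (fun i => unitItem (r i)) x = ∑ i ∈ accepted x, r i := by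
  simp only [planReward, unitItem_gain, accepted, Finset.sum_filter]

theorem exists_feasible_unitItem (r : Fin n → ℝ) (hb : 0 ≤ b ()) :
    ∃ x, Feasible (fun i => unitItem (r i)) b x :=
  ⟨acceptPlan ∅, by rwa [feasible_unitItem_iff, accepted_acceptPlan, Finset.card_empty,
    Nat.cast_zero]⟩

theorem isOptimal_of_mem_support (σ : Solver Unit Unit) (hb : 0 ≤ b ())
    (hx : x ∈ (σ.solve n (fun i => unitItem (r i)) b).support) :
    IsOptimal (fun i => unitItem (r i)) b x :=
  σ.optimal _ _ _ (exists_feasible_unitItem r hb) _ hx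

namespace IsOptimal

variable (hx : IsOptimal (fun i => unitItem (r i)) b x)
include hx

theorem card_accepted_le : (#(accepted x) : ℝ) ≤ b () := feasible_unitItem_iff.1 hx.1

theorem card_accepted_le_floor : #(accepted x) ≤ ⌊b ()⌋₊ := Nat.le_floor hx.card_accepted_le

theorem sum_le {S : Finset (Fin n)} (hS : #S ≤ ⌊b ()⌋₊) : ∑ i ∈ S, r i ≤ ∑ i ∈ accepted x, r i := by
  have hb : 0 ≤ b () := (Nat.cast_nonneg _).trans hx.card_accepted_le
  have h := hx.2 (acceptPlan S)
    (by rwa [feasible_unitItem_iff, accepted_acceptPlan, ← Nat.le_floor_iff hb])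
  rwa [planReward_unitItem, planReward_unitItem, accepted_acceptPlan] at h

theorem nonneg_of_mem_accepted {i : Fin n} (hi : i ∈ accepted x) : 0 ≤ r i := by
  have h := hx.sum_le ((Finset.card_erase_le (a := i)).trans hx.card_accepted_le_floor)
  rw [← Finset.add_sum_erase _ _ hi] at h
  linarith

theorem floor_le_card_accepted {i : Fin n} (hi : i ∉ accepted x) (hpos : 0 < r i) :
    ⌊b ()⌋₊ ≤ #(accepted x) := by
  by_contra! hlt
  have h := hx.sum_le (S := insert i (accepted x)) (by rwa [Finset.card_insert_of_notMem hi])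
  rw [Finset.sum_insert hi] at h
  linarith

theorem le_of_notMem_of_mem {i j : Fin n} (hi : i ∉ accepted x) (hj : j ∈ accepted x) :
    r i ≤ r j := by
  have hi' : i ∉ (accepted x).erase j := fun h => hi (Finset.mem_of_mem_erase h)
  have h := hx.sum_le (S := insert i ((accepted x).erase j))
    (by rw [Finset.card_insert_of_notMem hi', Finset.card_erase_add_one hj]
        exact hx.card_accepted_le_floor)
  rw [Finset.sum_insert hi', ← Finset.add_sum_erase _ _ hj] at h
  linarith

variable {S : Finset (Fin n)} (hpos : ∀ i ∈ S, 0 < r i) (hlt : ∀ i ∈ S, ∀ j ∉ S, r j < r i)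
include hpos hlt

theorem min_card_le_card_inter : min #S ⌊b ()⌋₊ ≤ #(accepted x ∩ S) := by
  by_contra! h
  obtain ⟨hS, hfloor⟩ := lt_min_iff.1 h
  obtain ⟨i, hiS, hi⟩ := Finset.exists_mem_notMem_of_card_lt_card hS
  have hix : i ∉ accepted x := fun hix => hi (Finset.mem_inter.2 ⟨hix, hiS⟩)
  obtain ⟨j, hjx, hj⟩ := Finset.exists_mem_notMem_of_card_lt_card
    (hfloor.trans_le (hx.floor_le_card_accepted hix (hpos i hiS)))
  have hjS : j ∉ S := fun hjS => hj (Finset.mem_inter.2 ⟨hjx, hjS⟩)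
  exact (hlt i hiS j hjS).not_ge (hx.le_of_notMem_of_mem hix hjx)

theorem card_sdiff_le : #(accepted x \ S) ≤ ⌊b ()⌋₊ - #S := by
  have hinter := hx.min_card_le_card_inter hpos hlt
  have hsplit := Finset.card_sdiff_add_card_inter (accepted x) S
  have htotal := hx.card_accepted_le_floor
  omega

end IsOptimal

end UnitItems

section AcceptProb

/-- The probability that a random decision, for a single supply node, is to accept. -/
noncomputable def acceptProb (q : PMF (Option Unit)) : ℝ := (q (some ())).toReal

theorem acceptProb_nonneg (q : PMF (Option Unit)) : 0 ≤ acceptProb q := ENNReal.toReal_nonneg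

theorem acceptProb_le_one (q : PMF (Option Unit)) : acceptProb q ≤ 1 :=
  ENNReal.toReal_mono ENNReal.one_ne_top (q.coe_le_one _)

theorem expect_eq_acceptProb (q : PMF (Option Unit)) (g : Option Unit → ℝ) :
    expect q g = acceptProb q * g (some ()) + (1 - acceptProb q) * g none := by
  have htotal := sum_toReal_eq_one q
  rw [Fintype.sum_option, Fintype.sum_unique] at htotal
  rw [expect, Fintype.sum_option, Fintype.sum_unique, acceptProb, ← htotal]
  simp only [PUnit.default_eq_unit]
  ring

variable {n : ℕ}

theorem acceptProb_map_apply (q : PMF (Fin n → Option Unit)) (i : Fin n) :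
    acceptProb (q.map fun x => x i) = expect q fun x => if i ∈ accepted x then 1 else 0 := by
  rw [acceptProb, PMF.map, toReal_bind_apply]
  refine congrArg _ (funext fun x => ?_)
  simp [mem_accepted, PMF.pure_apply, eq_comm (a := x i), apply_ite]

theorem sum_acceptProb (q : PMF (Fin n → Option Unit)) (S : Finset (Fin n)) :
    ∑ i ∈ S, acceptProb (q.map fun x => x i) = expect q fun x => (#(accepted x ∩ S) : ℝ) := by
  simp only [acceptProb_map_apply, ← expect_sum, Finset.sum_boole, Finset.filter_mem_eq_inter,
    Finset.inter_comm]

theorem Solver.Equivariant.map_apply_eq {J K : Type} {σ : Solver J K} (hσ : σ.Equivariant)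
    {a : Fin n → Item J K} {i j : Fin n} (h : a i = a j) (b : K → ℝ) :
    (σ.solve n a b).map (fun x => x i) = (σ.solve n a b).map fun x => x j := by
  have hswap : a ∘ Equiv.swap i j = a := by
    rw [Equiv.comp_swap_eq_update, h, Function.update_eq_self, ← h, Function.update_eq_self]
  have hlaw := hσ n a b (Equiv.swap i j)
  rw [hswap] at hlaw
  conv_lhs => rw [hlaw, PMF.map_comp]
  simp only [Function.comp_def, Equiv.swap_apply_left]

theorem Solver.Equivariant.card_mul_acceptProb {K : Type} {σ : Solver Unit K}
    (hσ : σ.Equivariant) {a : Fin n → Item Unit K} {S : Finset (Fin n)} {i : Fin n}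
    (hS : ∀ j ∈ S, a j = a i) (b : K → ℝ) :
    #S * acceptProb ((σ.solve n a b).map fun x => x i) =
      expect (σ.solve n a b) fun x => (#(accepted x ∩ S) : ℝ) := by
  rw [← sum_acceptProb, Finset.sum_congr rfl fun j hj =>
    congrArg acceptProb (hσ.map_apply_eq (hS j hj) b), Finset.sum_const, nsmul_eq_mul]

variable {σ : Solver Unit Unit} {r : Fin n → ℝ} {b : Unit → ℝ} {i : Fin n}

theorem acceptProb_solve_eq_zero (σ : Solver Unit Unit) (hb : 0 ≤ b ()) (hb1 : b () < 1) :
    acceptProb ((σ.solve n (fun i => unitItem (r i)) b).map fun x => x i) = 0 := by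
  rw [acceptProb_map_apply]
  refine expect_eq_of_support _ fun x hx => if_neg fun hi => ?_
  have hcard := (isOptimal_of_mem_support σ hb hx).card_accepted_le_floor
  rw [Nat.floor_eq_zero.2 hb1] at hcard
  exact (Finset.card_pos.2 ⟨i, hi⟩).not_ge hcard

theorem acceptProb_solve_mul_nonneg (σ : Solver Unit Unit) (hb : 0 ≤ b ()) :
    0 ≤ acceptProb ((σ.solve n (fun i => unitItem (r i)) b).map fun x => x i) * r i := by
  rw [acceptProb_map_apply, mul_comm, ← expect_const_mul]
  refine le_expect_of_support _ fun x hx => ?_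
  split_ifs with hi
  · simpa using (isOptimal_of_mem_support σ hb hx).nonneg_of_mem_accepted hi
  · rw [mul_zero]

variable {S : Finset (Fin n)} (hσ : σ.Equivariant) (hb : 0 ≤ b ())
  (hpos : ∀ i ∈ S, 0 < r i) (hlt : ∀ i ∈ S, ∀ j ∉ S, r j < r i)
include hσ hb hpos hlt

theorem le_acceptProb_solve_of_mem (hi : i ∈ S) (heq : ∀ j ∈ S, r j = r i) :
    min 1 ((⌊b ()⌋₊ : ℝ) / #S) ≤
      acceptProb ((σ.solve n (fun i => unitItem (r i)) b).map fun x => x i) := by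
  have hS : (0 : ℝ) < #S := Nat.cast_pos.2 (Finset.card_pos.2 ⟨i, hi⟩)
  rw [← div_self hS.ne', min_div_div_right hS.le, div_le_iff₀' hS,
    hσ.card_mul_acceptProb (fun j hj => congrArg unitItem (heq j hj)), ← Nat.cast_min]
  exact le_expect_of_support _ fun x hx => Nat.cast_le.2
    ((isOptimal_of_mem_support σ hb hx).min_card_le_card_inter hpos hlt)

theorem acceptProb_solve_le_of_notMem (hi : i ∉ S) (heq : ∀ j ∉ S, r j = r i) :
    acceptProb ((σ.solve n (fun i => unitItem (r i)) b).map fun x => x i) ≤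
      ((⌊b ()⌋₊ - #S : ℕ) : ℝ) / #Sᶜ := by
  have hS : (0 : ℝ) < #Sᶜ := Nat.cast_pos.2 (Finset.card_pos.2 ⟨i, Finset.mem_compl.2 hi⟩)
  rw [le_div_iff₀' hS, hσ.card_mul_acceptProb fun j hj =>
    congrArg unitItem (heq j (Finset.mem_compl.1 hj))]
  refine expect_le_of_support _ fun x hx => Nat.cast_le.2 ?_
  rw [← Finset.sdiff_eq_inter_compl]
  exact (isOptimal_of_mem_support σ hb hx).card_sdiff_le hpos hlt

end AcceptProb

section UnitLaw

variable {ι : Type} (q : PMF ι) (v : ι → ℝ) (P : Policy Unit Unit)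

theorem policyValue_unitItem_succ [Fintype ι] (m : ℕ) (r : ℝ) :
    policyValue (q.map fun c => unitItem (v c)) P (m + 1) (fun _ => r) =
      expect q fun c =>
        acceptProb (P m (fun _ => r) (unitItem (v c))) *
            (v c + policyValue (q.map fun c => unitItem (v c)) P m fun _ => r - 1) +
          (1 - acceptProb (P m (fun _ => r) (unitItem (v c)))) *
            policyValue (q.map fun c => unitItem (v c)) P m fun _ => r := by
  simp only [policyValue_succ, expect_eq_acceptProb, unitItem_gain, unitItem_consumption, if_true,
    reduceCtorEq, if_false, sub_zero, zero_add]

theorem policyValue_unitItem_eq_zero [Finite ι] {r : ℝ}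
    (hP : ∀ m c, acceptProb (P m (fun _ => r) (unitItem (v c))) = 0) (m : ℕ) :
    policyValue (q.map fun c => unitItem (v c)) P m (fun _ => r) = 0 := by
  have := Fintype.ofFinite ι
  induction m with
  | zero => exact policyValue_zero _ _ _
  | succ m ih =>
    simp only [policyValue_unitItem_succ, hP, ih, zero_mul, mul_zero, add_zero, expect_const]

variable (σ : Solver Unit Unit)

theorem acceptProb_myopic_eq_one (m : ℕ) {b : Unit → ℝ} (hb : 1 ≤ b ()) {w : ℝ} (hw : 0 < w) :
    acceptProb (myopic σ m b (unitItem w)) = 1 := by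
  rw [myopic, acceptProb_map_apply]
  refine expect_eq_of_support _ fun x hx => if_pos ?_
  by_contra h0
  have hfloor := (isOptimal_of_mem_support σ (zero_le_one.trans hb) hx).floor_le_card_accepted h0 hw
  have hempty : accepted x = ∅ :=
    Finset.eq_empty_of_forall_notMem fun i => Subsingleton.elim 0 i ▸ h0
  rw [hempty, Finset.card_empty] at hfloor
  exact (Nat.floor_pos.2 hb).not_ge hfloor

theorem policyValue_myopic [Fintype ι] (hv : ∀ c, 0 < v c) (m : ℕ) {r : ℝ} (hr : 0 ≤ r) :
    policyValue (q.map fun c => unitItem (v c)) (myopic σ) m (fun _ => r) =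
      (min m ⌊r⌋₊ : ℕ) * expect q v := by
  induction m generalizing r with
  | zero => simp [policyValue_zero]
  | succ m ih =>
    rcases lt_or_ge r 1 with hr1 | hr1
    · rw [policyValue_unitItem_eq_zero q v _ fun _ _ => acceptProb_solve_eq_zero σ hr hr1,
        Nat.floor_eq_zero.2 hr1, Nat.min_zero, Nat.cast_zero, zero_mul]
    · obtain ⟨k, hk⟩ := Nat.exists_eq_succ_of_ne_zero (Nat.floor_pos.2 hr1).ne'
      have haccept c := acceptProb_myopic_eq_one σ m (b := fun _ => r) hr1 (hv c)
      simp only [policyValue_unitItem_succ, haccept, ih (sub_nonneg.2 hr1), Nat.floor_sub_one, hk,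
        Nat.succ_sub_one, Nat.succ_min_succ, one_mul, sub_self, zero_mul, add_zero, expect_add,
        expect_const, Nat.cast_succ]
      ring

theorem acceptProb_oso [Fintype ι] (m : ℕ) (b : Unit → ℝ) (c : ι) :
    acceptProb (oso σ (q.map fun c => unitItem (v c)) m b (unitItem (v c))) =
      expect (iid q m) fun s => acceptProb ((σ.solve (m + 1)
        (fun i => unitItem (v ((Fin.cons c s : Fin (m + 1) → ι) i))) b).map fun x => x 0) := by
  rw [oso, iid_map, PMF.bind_map, acceptProb, toReal_bind_apply]
  refine congrArg _ (funext fun s => ?_)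
  rw [Function.comp_apply, ← Fin.comp_cons (fun c => unitItem (v c)) c s]
  rfl

theorem acceptProb_oso_eq_zero [Finite ι] (m : ℕ) {b : Unit → ℝ} (hb : 0 ≤ b ())
    (hb1 : b () < 1) (c : ι) :
    acceptProb (oso σ (q.map fun c => unitItem (v c)) m b (unitItem (v c))) = 0 := by
  have := Fintype.ofFinite ι
  rw [acceptProb_oso]
  exact expect_eq_of_support _ fun s _ => acceptProb_solve_eq_zero σ hb hb1

theorem acceptProb_oso_mul_nonneg [Finite ι] (m : ℕ) {b : Unit → ℝ} (hb : 0 ≤ b ()) (c : ι) :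
    0 ≤ acceptProb (oso σ (q.map fun c => unitItem (v c)) m b (unitItem (v c))) * v c := by
  have := Fintype.ofFinite ι
  rw [acceptProb_oso, mul_comm, ← expect_const_mul]
  refine expect_nonneg _ fun s => ?_
  rw [mul_comm]
  exact acceptProb_solve_mul_nonneg (i := 0)
    (r := fun i => v ((Fin.cons c s : Fin (m + 1) → ι) i)) σ hb

end UnitLaw

section CoinLaw

variable (p : ℝ≥0) (hp : p ≤ 1) (φ : ℝ)

/-- The law of a unit item whose value is `1` with probability `p` and `φ` otherwise. -/
noncomputable def coinLaw : PMF (Item Unit Unit) :=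
  (coin p hp).map fun c => unitItem (cond c 1 φ)

theorem policyValue_coinLaw_succ (P : Policy Unit Unit) (m : ℕ) (r : ℝ) :
    policyValue (coinLaw p hp φ) P (m + 1) (fun _ => r) =
      p * (acceptProb (P m (fun _ => r) (unitItem 1)) *
            (1 + policyValue (coinLaw p hp φ) P m fun _ => r - 1) +
          (1 - acceptProb (P m (fun _ => r) (unitItem 1))) *
            policyValue (coinLaw p hp φ) P m fun _ => r) +
      (1 - p) * (acceptProb (P m (fun _ => r) (unitItem φ)) *
            (φ + policyValue (coinLaw p hp φ) P m fun _ => r - 1) +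
          (1 - acceptProb (P m (fun _ => r) (unitItem φ))) *
            policyValue (coinLaw p hp φ) P m fun _ => r) := by
  rw [coinLaw, policyValue_unitItem_succ, expect_coin]
  rfl

variable {φ} {σ : Solver Unit Unit} (hσ : σ.Equivariant) (hφ : φ < 1) (m : ℕ) {b : Unit → ℝ}
  (hb : 0 ≤ b ())
include hσ hφ hb

theorem le_acceptProb_oso_one :
    expect (iid (coin p hp) m) (fun s => min 1 ((⌊b ()⌋₊ : ℝ) / (numTrue s + 1))) ≤
      acceptProb (oso σ (coinLaw p hp φ) m b (unitItem 1)) := by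
  refine le_of_le_of_eq (expect_mono _ fun s => ?_) (acceptProb_oso _ _ σ m b true).symm
  set t : Fin (m + 1) → Bool := Fin.cons true s with ht
  have hmem : ∀ i, i ∈ ({i | t i = true} : Finset _) ↔ t i = true := fun i => by simp
  refine le_of_eq_of_le ?_ (le_acceptProb_solve_of_mem (r := fun i => cond (t i) 1 φ)
    (S := {i | t i = true}) hσ hb ?_ ?_ ((hmem 0).2 rfl) ?_)
  · rw [← Nat.cast_add_one, ← numTrue_cons_true, numTrue]
  all_goals simp +contextual [hφ, ht]

theorem acceptProb_oso_le :
    acceptProb (oso σ (coinLaw p hp φ) m b (unitItem φ)) ≤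
      expect (iid (coin p hp) m) fun s =>
        ((⌊b ()⌋₊ - numTrue s : ℕ) : ℝ) / (m + 1 - numTrue s) := by
  refine le_of_eq_of_le (acceptProb_oso _ _ σ m b false) (expect_mono _ fun s => ?_)
  set t : Fin (m + 1) → Bool := Fin.cons false s with ht
  have hmem : ∀ i, i ∈ ({i | t i = true} : Finset _) ↔ t i = true := fun i => by simp
  refine le_of_le_of_eq (acceptProb_solve_le_of_notMem (r := fun i => cond (t i) 1 φ)
    (S := {i | t i = true}) hσ hb ?_ ?_ (mt (hmem 0).1 (by simp [ht])) ?_) ?_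
  · simp +contextual [hmem]
  · simp +contextual [hmem, hφ]
  · simp +contextual [ht]
  · rw [Finset.card_compl, ← numTrue, numTrue_cons_false, Fintype.card_fin,
      Nat.cast_sub ((numTrue_le s).trans m.le_succ), Nat.cast_add_one]

end CoinLaw

section Benchmark

variable (p : ℝ≥0) (hp : p ≤ 1)

/-- The expected number of successes, truncated at `c`: the value of `c` units of capacity when
only the items of value `1` count. -/
noncomputable def truncMean (m c : ℕ) : ℝ :=
  expect (iid (coin p hp) m) fun s => (min (numTrue s) c : ℕ)

/-- The probability of at least `c` successes: the marginal value of the `c`-th unit of capacity. -/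
noncomputable def tailProb (m c : ℕ) : ℝ :=
  expect (iid (coin p hp) m) fun s => if c ≤ numTrue s then 1 else 0

theorem truncMean_zero_left (c : ℕ) : truncMean p hp 0 c = 0 := by
  simp [truncMean, expect_iid_zero, numTrue]

theorem truncMean_zero_right (m : ℕ) : truncMean p hp m 0 = 0 := by
  simp [truncMean, expect_const]

theorem truncMean_succ_right (m k : ℕ) :
    truncMean p hp m (k + 1) = truncMean p hp m k + tailProb p hp m (k + 1) := by
  rw [truncMean, truncMean, tailProb, ← expect_add]
  refine congrArg _ (funext fun s => ?_)
  split_ifs with h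
  · rw [min_eq_right h, min_eq_right (by lia), Nat.cast_add_one]
  · rw [min_eq_left (by lia), min_eq_left (by lia), add_zero]

theorem truncMean_succ_succ (m k : ℕ) :
    truncMean p hp (m + 1) (k + 1) =
      p * (1 + truncMean p hp m k) + (1 - p) * truncMean p hp m (k + 1) := by
  simp only [truncMean, expect_iid_coin_succ, numTrue_cons_true, numTrue_cons_false,
    Nat.add_min_add_right, Nat.cast_add_one, expect_add, expect_const]
  ring

theorem tailProb_nonneg (m c : ℕ) : 0 ≤ tailProb p hp m c :=
  expect_nonneg _ fun _ => by split_ifs <;> norm_num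

theorem one_sub_tailProb (m c : ℕ) :
    1 - tailProb p hp m c =
      expect (iid (coin p hp) m) fun s => if numTrue s < c then 1 else 0 := by
  rw [sub_eq_iff_eq_add, tailProb, ← expect_add]
  refine (expect_const (iid (coin p hp) m) 1).symm.trans (congrArg _ (funext fun s => ?_))
  simp only [← not_le, ite_not]
  split_ifs <;> norm_num

theorem tailProb_le_one (m c : ℕ) : tailProb p hp m c ≤ 1 := by
  rw [← sub_nonneg, one_sub_tailProb]
  exact expect_nonneg _ fun _ => by split_ifs <;> norm_num

theorem tailProb_zero_left {c : ℕ} (hc : 1 ≤ c) : tailProb p hp 0 c = 0 := by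
  rw [tailProb, expect_iid_zero, if_neg (by simp [numTrue]; lia)]

theorem mul_tailProb_le (m c : ℕ) : c * tailProb p hp m c ≤ m * p := by
  rw [← expect_numTrue p hp, tailProb, ← expect_const_mul]
  refine expect_mono _ fun s => ?_
  split_ifs with h
  · rw [mul_one]
    exact_mod_cast h
  · simp

theorem sub_sqrt_le_truncMean (m : ℕ) :
    m * p - 1 - √(m * p) ≤ truncMean p hp m ⌊(m * p : ℝ)⌋₊ := by
  calc (m * p - 1 - √(m * p) : ℝ)
      ≤ expect (iid (coin p hp) m) fun s => m * p - 1 - |(numTrue s : ℝ) - m * p| := by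
        rw [expect_sub, expect_const]
        exact sub_le_sub_left (expect_abs_numTrue_sub_le p hp m) _
    _ ≤ truncMean p hp m ⌊(m * p : ℝ)⌋₊ := expect_mono _ fun s => by
        have hfloor := Nat.lt_floor_add_one (m * p : ℝ)
        have hnonneg := abs_nonneg ((numTrue s : ℝ) - m * p)
        have hdev := neg_abs_le ((numTrue s : ℝ) - m * p)
        rw [Nat.cast_min]
        exact le_min (by linarith) (by linarith)

end Benchmark

section Regret

theorem mul_sub_le_mul_abs_add_abs {μ a b : ℝ} (hμ : 0 ≤ μ) (ha : 0 ≤ a) (hb : 0 ≤ b) :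
    μ * (a - b) ≤ a * (|a - μ| + |b - μ|) := by
  rcases le_total a b with hab | hab
  · exact (mul_nonpos_of_nonneg_of_nonpos hμ (sub_nonpos.2 hab)).trans (by positivity)
  rcases le_total μ a with hμa | hμa
  · exact mul_le_mul hμa (by linarith [le_abs_self (a - μ), neg_abs_le (b - μ)])
      (sub_nonneg.2 hab) ha
  · calc μ * (a - b) ≤ a * (μ - b) := by linarith [mul_le_mul_of_nonneg_right hμa hb]
      _ ≤ a * (|a - μ| + |b - μ|) := mul_le_mul_of_nonneg_left
          (by linarith [abs_nonneg (a - μ), neg_abs_le (b - μ)]) ha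

theorem mul_one_sub_min_le {μ a b c : ℝ} (hμ : 0 ≤ μ) (ha : 0 ≤ a) (hb : 0 ≤ b)
    (hbc : b + 1 ≤ c) : μ * (1 - min 1 (c / (a + 1))) ≤ |a - μ| + |b - μ| := by
  rcases le_total 1 (c / (a + 1)) with h | h
  · rw [min_eq_left h, sub_self, mul_zero]
    positivity
  · have ha1 : 0 < a + 1 := by linarith
    rw [min_eq_right h, one_sub_div ha1.ne', ← mul_div_assoc, div_le_iff₀' ha1]
    calc μ * (a + 1 - c) ≤ μ * (a - b) := mul_le_mul_of_nonneg_left (by linarith) hμ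
      _ ≤ a * (|a - μ| + |b - μ|) := mul_sub_le_mul_abs_add_abs hμ ha hb
      _ ≤ (a + 1) * (|a - μ| + |b - μ|) :=
          mul_le_mul_of_nonneg_right (by linarith) (by positivity)

theorem mul_sub_div_le {m a b c : ℕ} (μ : ℝ) (hcb : c ≤ b) (hcm : 2 * c ≤ m) :
    m * (((c - a : ℕ) : ℝ) / (m + 1 - a)) ≤ 2 * (|a - μ| + |b - μ|) := by
  rcases le_total c a with hca | hca
  · rw [Nat.sub_eq_zero_of_le hca, Nat.cast_zero, zero_div, mul_zero]
    positivity
  · have hca' : (a : ℝ) ≤ c := by exact_mod_cast hca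
    have hcb' : (c : ℝ) ≤ b := by exact_mod_cast hcb
    have hcm' : 2 * (c : ℝ) ≤ m := by exact_mod_cast hcm
    have hgap : (c : ℝ) - a ≤ |(a : ℝ) - μ| + |(b : ℝ) - μ| := by
      linarith [neg_abs_le ((a : ℝ) - μ), le_abs_self ((b : ℝ) - μ)]
    rw [Nat.cast_sub hca, ← mul_div_assoc, div_le_iff₀ (by linarith)]
    calc (m : ℝ) * (c - a) ≤ 2 * (m + 1 - a) * (|(a : ℝ) - μ| + |(b : ℝ) - μ|) :=
          mul_le_mul (by linarith) hgap (sub_nonneg.2 hca') (by linarith)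
      _ = 2 * (|(a : ℝ) - μ| + |(b : ℝ) - μ|) * (m + 1 - a) := by ring

variable (p : ℝ≥0) (hp : p ≤ 1) {m c : ℕ} {α β : ℝ}

theorem mul_rejectionLoss_le
    (hα : expect (iid (coin p hp) m) (fun s => min 1 ((c : ℝ) / (numTrue s + 1))) ≤ α) :
    m * (p * ((1 - α) * (1 - tailProb p hp m c))) ≤ 2 * √(m * p) := by
  set law := iid (coin p hp) m
  have hreject : 1 - α ≤ expect law fun s => 1 - min 1 ((c : ℝ) / (numTrue s + 1)) := by
    rw [expect_sub, expect_const]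
    exact sub_le_sub_left hα 1
  calc (m * (p * ((1 - α) * (1 - tailProb p hp m c))) : ℝ)
      ≤ m * p * ((expect law fun s => 1 - min 1 ((c : ℝ) / (numTrue s + 1))) *
          (1 - tailProb p hp m c)) := by
        rw [← mul_assoc]
        exact mul_le_mul_of_nonneg_left
          (mul_le_mul_of_nonneg_right hreject (sub_nonneg.2 (tailProb_le_one p hp m c)))
          (by positivity)
    _ = (expect law fun s => m * p * (1 - min 1 ((c : ℝ) / (numTrue s + 1)))) *
          expect law fun s => if numTrue s < c then 1 else 0 := by
        rw [expect_const_mul, one_sub_tailProb]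
        ring
    _ ≤ (expect law fun s => |(numTrue s : ℝ) - m * p|) +
          expect law fun s => |(numTrue s : ℝ) - m * p| := by
        refine expect_mul_expect_le _ _ fun s t => ?_
        split_ifs with h
        · rw [mul_one]
          exact mul_one_sub_min_le (by positivity) (by positivity) (by positivity)
            (by exact_mod_cast h)
        · rw [mul_zero]
          positivity
    _ ≤ 2 * √(m * p) := by linarith [expect_abs_numTrue_sub_le p hp m]

theorem mul_acceptanceLoss_le_of_two_mul_le (hcm : 2 * c ≤ m)
    (hβ : β ≤ expect (iid (coin p hp) m)
      fun s => ((c - numTrue s : ℕ) : ℝ) / (m + 1 - numTrue s)) :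
    m * (β * tailProb p hp m c) ≤ 4 * √(m * p) := by
  set law := iid (coin p hp) m
  calc (m * (β * tailProb p hp m c) : ℝ)
      ≤ m * ((expect law fun s => ((c - numTrue s : ℕ) : ℝ) / (m + 1 - numTrue s)) *
          tailProb p hp m c) :=
        mul_le_mul_of_nonneg_left (mul_le_mul_of_nonneg_right hβ (tailProb_nonneg p hp m c))
          m.cast_nonneg
    _ = (expect law fun s => m * (((c - numTrue s : ℕ) : ℝ) / (m + 1 - numTrue s))) *
          expect law fun s => if c ≤ numTrue s then 1 else 0 := by
        rw [expect_const_mul, tailProb, mul_assoc]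
    _ ≤ (expect law fun s => 2 * |(numTrue s : ℝ) - m * p|) +
          expect law fun s => 2 * |(numTrue s : ℝ) - m * p| := by
        refine expect_mul_expect_le _ _ fun s t => ?_
        split_ifs with h
        · rw [mul_one, ← mul_add]
          exact mul_sub_div_le _ h hcm
        · rw [mul_zero]
          positivity
    _ ≤ 4 * √(m * p) := by
        rw [expect_const_mul]
        linarith [expect_abs_numTrue_sub_le p hp m]

theorem mul_acceptanceLoss_le_of_le_two_mul (hmc : m ≤ 2 * c) (hcp : (c * p : ℝ) ≤ 1)
    (hβ1 : β ≤ 1) :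
    m * (β * tailProb p hp m c) ≤ 4 * √(m * p) := by
  have hmc' : (m : ℝ) ≤ 2 * c := by exact_mod_cast hmc
  have hmp : (m * p : ℝ) ≤ 2 ^ 2 := by
    linarith [mul_le_mul_of_nonneg_right hmc' p.coe_nonneg]
  have htail := tailProb_nonneg p hp m c
  calc m * (β * tailProb p hp m c) ≤ m * tailProb p hp m c :=
        mul_le_mul_of_nonneg_left (mul_le_of_le_one_left htail hβ1) m.cast_nonneg
    _ ≤ 2 * c * tailProb p hp m c := mul_le_mul_of_nonneg_right hmc' htail
    _ ≤ 2 * (m * p) := by linarith [mul_tailProb_le p hp m c]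
    _ = 2 * (√(m * p) * √(m * p)) := by rw [Real.mul_self_sqrt (by positivity)]
    _ ≤ 2 * (2 * √(m * p)) := by
        gcongr
        exact Real.sqrt_le_iff.2 ⟨zero_le_two, hmp⟩
    _ = 4 * √(m * p) := by ring

theorem mul_sqrt_le_mul_sqrt_succ {x y : ℝ} (hx : 1 ≤ x) (hy : 0 ≤ y) :
    (3 * x + 1) * √(x * y) ≤ 3 * x * √((x + 1) * y) := by
  rw [← sq_le_sq₀ (by positivity) (by positivity), mul_pow, mul_pow, Real.sq_sqrt (by positivity),
    Real.sq_sqrt (by positivity)]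
  nlinarith [mul_nonneg hy (mul_nonneg (zero_le_one.trans hx) (sub_nonneg.2 hx))]

theorem mul_loss_le (hcp : (c * p : ℝ) ≤ 1)
    (hα : expect (iid (coin p hp) m) (fun s => min 1 ((c : ℝ) / (numTrue s + 1))) ≤ α)
    (hβ0 : 0 ≤ β) (hβ1 : β ≤ 1)
    (hβ : β ≤ expect (iid (coin p hp) m)
      fun s => ((c - numTrue s : ℕ) : ℝ) / (m + 1 - numTrue s)) :
    m * (p * ((1 - α) * (1 - tailProb p hp m c)) + (1 - p) * (β * tailProb p hp m c)) ≤
      6 * √(m * p) := by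
  have haccept : m * (β * tailProb p hp m c) ≤ 4 * √(m * p) :=
    (le_total (2 * c) m).elim (fun h => mul_acceptanceLoss_le_of_two_mul_le p hp h hβ)
      fun h => mul_acceptanceLoss_le_of_le_two_mul p hp h hcp hβ1
  have hweight : (1 - p) * (β * tailProb p hp m c) ≤ β * tailProb p hp m c :=
    mul_le_of_le_one_left (mul_nonneg hβ0 (tailProb_nonneg p hp m c)) (sub_le_self 1 p.coe_nonneg)
  calc _ ≤ m * (p * ((1 - α) * (1 - tailProb p hp m c))) + m * (β * tailProb p hp m c) := by
        rw [mul_add]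
        exact add_le_add_right (mul_le_mul_of_nonneg_left hweight m.cast_nonneg) _
    _ ≤ 6 * √(m * p) := by linarith [mul_rejectionLoss_le p hp hα]

theorem loss_add_sqrt_le (hc : 1 ≤ c) (hcp : (c * p : ℝ) ≤ 1)
    (hα : expect (iid (coin p hp) m) (fun s => min 1 ((c : ℝ) / (numTrue s + 1))) ≤ α)
    (hβ0 : 0 ≤ β) (hβ1 : β ≤ 1)
    (hβ : β ≤ expect (iid (coin p hp) m)
      fun s => ((c - numTrue s : ℕ) : ℝ) / (m + 1 - numTrue s)) :
    p * ((1 - α) * (1 - tailProb p hp m c)) + (1 - p) * (β * tailProb p hp m c) +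
      18 * √(m * p) ≤ 18 * √((m + 1 : ℕ) * p) := by
  rcases m.eq_zero_or_pos with rfl | hm
  · have hα1 : 1 ≤ α := by
      rw [expect_iid_zero] at hα
      refine le_trans (le_min le_rfl ?_) hα
      simpa [numTrue] using hc
    rw [tailProb_zero_left p hp hc, Nat.cast_zero, zero_mul, Real.sqrt_zero]
    have hloss : p * ((1 - α) * (1 - 0)) ≤ 0 :=
      mul_nonpos_of_nonneg_of_nonpos p.coe_nonneg (by linarith)
    linarith [Real.sqrt_nonneg ((0 + 1 : ℕ) * p : ℝ)]
  · have hm1 : (1 : ℝ) ≤ m := by exact_mod_cast hm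
    have hloss := mul_loss_le p hp hcp hα hβ0 hβ1 hβ
    have hstep := mul_sqrt_le_mul_sqrt_succ hm1 p.coe_nonneg
    rw [Nat.cast_add_one]
    refine le_of_mul_le_mul_left ?_ (zero_lt_one.trans_le hm1)
    linarith

theorem bellman_step_le {q α β φ w G v₀ v₁ S S' : ℝ} (hq0 : 0 ≤ q) (hq1 : q ≤ 1)
    (hα0 : 0 ≤ α) (hα1 : α ≤ 1) (hβ0 : 0 ≤ β) (hβ1 : β ≤ 1) (hβφ : 0 ≤ β * φ)
    (h₀ : w - S ≤ v₀) (h₁ : w + G - S ≤ v₁)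
    (hloss : q * ((1 - α) * (1 - G)) + (1 - q) * (β * G) + S ≤ S') :
    q * (1 + w) + (1 - q) * (w + G) - S' ≤
      q * (α * (1 + v₀) + (1 - α) * v₁) + (1 - q) * (β * (φ + v₀) + (1 - β) * v₁) := by
  have hcont {γ : ℝ} (hγ0 : 0 ≤ γ) (hγ1 : γ ≤ 1) :
      γ * (w - S) + (1 - γ) * (w + G - S) ≤ γ * v₀ + (1 - γ) * v₁ :=
    add_le_add (mul_le_mul_of_nonneg_left h₀ hγ0)
      (mul_le_mul_of_nonneg_left h₁ (sub_nonneg.2 hγ1))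
  calc q * (1 + w) + (1 - q) * (w + G) - S'
      ≤ q * (α + (α * (w - S) + (1 - α) * (w + G - S))) +
          (1 - q) * (β * (w - S) + (1 - β) * (w + G - S)) := by linarith
    _ ≤ q * (α + (α * v₀ + (1 - α) * v₁)) + (1 - q) * (β * φ + (β * v₀ + (1 - β) * v₁)) :=
        add_le_add
          (mul_le_mul_of_nonneg_left (add_le_add_right (hcont hα0 hα1) _) hq0)
          (mul_le_mul_of_nonneg_left (le_add_of_nonneg_of_le hβφ (hcont hβ0 hβ1))
            (sub_nonneg.2 hq1))
    _ = _ := by ring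

theorem truncMean_sub_sqrt_le_policyValue_oso {φ : ℝ} (hφ : φ < 1) {σ : Solver Unit Unit}
    (hσ : σ.Equivariant) (m : ℕ) {r : ℝ} (hr : 0 ≤ r) (hrp : r * p ≤ 1) :
    truncMean p hp m ⌊r⌋₊ - 18 * √(m * p) ≤
      policyValue (coinLaw p hp φ) (oso σ (coinLaw p hp φ)) m fun _ => r := by
  induction m generalizing r with
  | zero => simp [truncMean_zero_left, policyValue_zero]
  | succ m ih =>
    rcases lt_or_ge r 1 with hr1 | hr1
    · rw [Nat.floor_eq_zero.2 hr1, truncMean_zero_right, coinLaw, policyValue_unitItem_eq_zero _ _ _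
        fun m c => acceptProb_oso_eq_zero _ _ σ m hr hr1 c]
      linarith [Real.sqrt_nonneg ((m + 1 : ℕ) * p : ℝ)]
    · obtain ⟨k, hk⟩ := Nat.exists_eq_succ_of_ne_zero (Nat.floor_pos.2 hr1).ne'
      have hone := le_acceptProb_oso_one p hp hσ hφ m (b := fun _ => r) hr
      have hlow := acceptProb_oso_le p hp hσ hφ m (b := fun _ => r) hr
      have hfloor : ⌊r⌋₊ * (p : ℝ) ≤ 1 :=
        (mul_le_mul_of_nonneg_right (Nat.floor_le hr) p.coe_nonneg).trans hrp
      have hspend := ih (sub_nonneg.2 hr1) (by linarith [p.coe_nonneg])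
      have hkeep := ih hr hrp
      have hloss := loss_add_sqrt_le p hp (Nat.floor_pos.2 hr1) hfloor hone
        (acceptProb_nonneg _) (acceptProb_le_one _) hlow
      rw [Nat.floor_sub_one, hk, Nat.succ_sub_one] at hspend
      rw [hk, truncMean_succ_right] at hkeep
      rw [hk] at hloss
      rw [hk, truncMean_succ_succ, truncMean_succ_right, policyValue_coinLaw_succ]
      exact bellman_step_le p.coe_nonneg hp (acceptProb_nonneg _) (acceptProb_le_one _)
        (acceptProb_nonneg _) (acceptProb_le_one _)
        (acceptProb_oso_mul_nonneg _ (fun c => cond c 1 φ) σ m (b := fun _ => r) hr false)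
        hspend hkeep hloss

end Regret

section Optimum

variable {n : ℕ} {r : Fin n → ℝ} {b : Unit → ℝ}

theorem offlineOpt_unitItem_le (hr : ∀ i, r i ≤ 1) (hb : 0 ≤ b ()) :
    offlineOpt (fun i => unitItem (r i)) b ≤ b () := by
  obtain ⟨x, hx⟩ := exists_feasible_unitItem r hb
  refine csSup_le ⟨_, x, hx, rfl⟩ ?_
  rintro _ ⟨y, hy, rfl⟩
  calc planReward (fun i => unitItem (r i)) y = ∑ i ∈ accepted y, r i := planReward_unitItem r y
    _ ≤ #(accepted y) • (1 : ℝ) := Finset.sum_le_card_nsmul _ _ _ fun i _ => hr i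
    _ ≤ b () := by rw [nsmul_one]; exact feasible_unitItem_iff.1 hy

theorem sum_le_offlineOpt (hb : 0 ≤ b ()) {S : Finset (Fin n)} (hS : #S ≤ ⌊b ()⌋₊) :
    ∑ i ∈ S, r i ≤ offlineOpt (fun i => unitItem (r i)) b := by
  have hfinite : {v | ∃ x, Feasible (fun i => unitItem (r i)) b x ∧
      planReward (fun i => unitItem (r i)) x = v}.Finite :=
    (Set.finite_range (planReward fun i => unitItem (r i))).subset fun _ ⟨x, _, hx⟩ => ⟨x, hx⟩
  refine le_csSup hfinite.bddAbove ⟨acceptPlan S, ?_, ?_⟩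
  · rwa [feasible_unitItem_iff, accepted_acceptPlan, ← Nat.le_floor_iff hb]
  · rw [planReward_unitItem, accepted_acceptPlan]

theorem min_numTrue_le_offlineOpt (φ : ℝ) (hb : 0 ≤ b ()) (t : Fin n → Bool) :
    (min (numTrue t) ⌊b ()⌋₊ : ℕ) ≤ offlineOpt (fun i => unitItem (cond (t i) 1 φ)) b := by
  obtain ⟨S, hS, hcard⟩ := Finset.exists_subset_card_eq (min_le_left (numTrue t) ⌊b ()⌋₊)
  refine le_of_eq_of_le ?_ (sum_le_offlineOpt hb (hcard.trans_le (min_le_right _ _)))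
  have hvalue : ∀ i ∈ S, cond (t i) 1 φ = 1 := fun i hi => by
    rw [(Finset.mem_filter.1 (hS hi)).2, cond_true]
  rw [Finset.sum_congr rfl hvalue, Finset.sum_const, hcard, nsmul_one]

end Optimum

section Example

open Filter Topology

variable {φ : ℝ} {T : ℕ}

theorem natCast_mul_one_div_sqrt (T : ℕ) : T * ((1 / NNReal.sqrt T : ℝ≥0) : ℝ) = √T := by
  rw [NNReal.coe_div, NNReal.coe_one, Real.coe_sqrt, NNReal.coe_natCast, mul_one_div, Real.div_sqrt]

theorem expectedOPT_eq (φ : ℝ) (T : ℕ) :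
    (example₁ φ T).expectedOPT = expect (iid (coin _ (one_div_sqrt_le_one T)) T) fun t =>
      offlineOpt (fun i => unitItem (cond (t i) 1 φ)) fun _ => √T := by
  rw [Problem.expectedOPT, example₁, iid_map, PMF.map_comp, mean_map]
  rfl

theorem expectedOPT_le (hφ : φ ≤ 1) (T : ℕ) : (example₁ φ T).expectedOPT ≤ √T := by
  rw [expectedOPT_eq]
  exact expect_le_of_support _ fun t _ => offlineOpt_unitItem_le (b := fun _ => √T)
    (fun i => by cases t i <;> simp [hφ]) (Real.sqrt_nonneg _)

theorem truncMean_le_expectedOPT (φ : ℝ) (T : ℕ) :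
    truncMean _ (one_div_sqrt_le_one T) T ⌊√(T : ℝ)⌋₊ ≤ (example₁ φ T).expectedOPT := by
  rw [expectedOPT_eq]
  exact expect_mono _ fun t => min_numTrue_le_offlineOpt (b := fun _ => √T) φ (Real.sqrt_nonneg _) t

theorem expectedOPT_nonneg (φ : ℝ) (T : ℕ) : 0 ≤ (example₁ φ T).expectedOPT :=
  (expect_nonneg _ fun _ => Nat.cast_nonneg _).trans (truncMean_le_expectedOPT φ T)

theorem one_sub_mul_sqrt_le_truncMean_sub (hT : 1 ≤ T) :
    (1 - 20 / √√T) * √T ≤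
      truncMean _ (one_div_sqrt_le_one T) T ⌊√(T : ℝ)⌋₊ - 18 * √√T := by
  have hone : 1 ≤ √√(T : ℝ) := by
    rw [Real.one_le_sqrt, Real.one_le_sqrt]
    exact_mod_cast hT
  have hdiv : 20 / √√(T : ℝ) * √T = 20 * √√T := by
    rw [div_mul_eq_mul_div, mul_div_assoc, Real.div_sqrt]
  have hmean := sub_sqrt_le_truncMean _ (one_div_sqrt_le_one T) T
  rw [natCast_mul_one_div_sqrt] at hmean
  linarith

theorem le_expectedOSO (hφ : φ < 1) (hT : 1 ≤ T) {σ : Solver Unit Unit} (hσ : σ.Equivariant) :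
    (1 - 20 / √√T) * √T ≤ (example₁ φ T).expectedOSO σ := by
  have hbudget : √(T : ℝ) * ((1 / NNReal.sqrt T : ℝ≥0) : ℝ) ≤ 1 := by
    simpa using mul_inv_le_one
  have hregret := truncMean_sub_sqrt_le_policyValue_oso _ (one_div_sqrt_le_one T) hφ hσ T
    (Real.sqrt_nonneg T) hbudget
  rw [natCast_mul_one_div_sqrt] at hregret
  exact (one_sub_mul_sqrt_le_truncMean_sub hT).trans hregret

theorem le_expectedOPT (φ : ℝ) (hT : 1 ≤ T) :
    (1 - 20 / √√T) * √T ≤ (example₁ φ T).expectedOPT :=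
  (one_sub_mul_sqrt_le_truncMean_sub hT).trans
    ((sub_le_self _ (by positivity)).trans (truncMean_le_expectedOPT φ T))

theorem expectedMyopic_eq (hφ : 0 < φ) (T : ℕ) (σ : Solver Unit Unit) :
    (example₁ φ T).expectedMyopic σ = ⌊√(T : ℝ)⌋₊ * (1 * (1 / √T) + φ * (1 - 1 / √T)) := by
  have hfloor : ⌊√(T : ℝ)⌋₊ ≤ T := by
    rw [Real.nat_floor_real_sqrt_eq_nat_sqrt]
    exact Nat.sqrt_le_self T
  have hvalue := policyValue_myopic (coin _ (one_div_sqrt_le_one T)) (fun c => cond c 1 φ) σ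
    (fun c => by cases c <;> simp [hφ]) T (Real.sqrt_nonneg T)
  rw [min_eq_right hfloor, expect_coin, cond_true, cond_false] at hvalue
  refine hvalue.trans ?_
  push_cast
  ring

theorem expectedMyopic_pos (hφ : 0 < φ) (hT : 1 ≤ T) (σ : Solver Unit Unit) :
    0 < (example₁ φ T).expectedMyopic σ := by
  have hsqrt : 1 ≤ √(T : ℝ) := by
    rw [Real.one_le_sqrt]
    exact_mod_cast hT
  have hinv : 1 / √(T : ℝ) ≤ 1 := (div_le_one (by linarith)).2 hsqrt
  rw [expectedMyopic_eq hφ]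
  exact mul_pos (by exact_mod_cast Nat.floor_pos.2 hsqrt)
    (add_pos_of_pos_of_nonneg (by positivity) (mul_nonneg hφ.le (sub_nonneg.2 hinv)))

theorem tendsto_sqrt_natCast : Tendsto (fun T : ℕ => √(T : ℝ)) atTop atTop :=
  Real.tendsto_sqrt_atTop.comp tendsto_natCast_atTop_atTop

theorem tendsto_one_sub_div_sqrt_sqrt (C : ℝ) :
    Tendsto (fun T : ℕ => 1 - C / √√(T : ℝ)) atTop (𝓝 1) := by
  simpa using
    ((Real.tendsto_sqrt_atTop.comp tendsto_sqrt_natCast).const_div_atTop C).const_sub 1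

theorem tendsto_expectedOPT_div_sqrt (hφ : φ ≤ 1) :
    Tendsto (fun T : ℕ => (example₁ φ T).expectedOPT / √T) atTop (𝓝 1) := by
  refine tendsto_of_tendsto_of_tendsto_of_le_of_le' (tendsto_one_sub_div_sqrt_sqrt 20)
    tendsto_const_nhds ?_ ?_ <;> filter_upwards [eventually_ge_atTop 1] with T hT
  · exact (le_div_iff₀ (Real.sqrt_pos.2 (by exact_mod_cast hT))).2 (le_expectedOPT φ hT)
  · exact div_le_one_of_le₀ (expectedOPT_le hφ T) (Real.sqrt_nonneg _)

theorem tendsto_floor_sqrt_mul_div_sqrt (φ : ℝ) :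
    Tendsto (fun T : ℕ => ⌊√(T : ℝ)⌋₊ * (1 * (1 / √T) + φ * (1 - 1 / √T)) / √T) atTop (𝓝 φ) := by
  have hinv : Tendsto (fun T : ℕ => 1 / √(T : ℝ)) atTop (𝓝 0) :=
    tendsto_sqrt_natCast.const_div_atTop 1
  have hfloor : Tendsto (fun T : ℕ => (⌊√(T : ℝ)⌋₊ : ℝ) / √T) atTop (𝓝 1) :=
    (tendsto_nat_floor_div_atTop (R := ℝ)).comp tendsto_sqrt_natCast
  have hprod := hfloor.mul ((hinv.const_mul 1).add ((hinv.const_sub 1).const_mul φ))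
  simp only [mul_zero, sub_zero, mul_one, zero_add, one_mul] at hprod
  refine hprod.congr fun T => ?_
  rw [one_mul, div_mul_eq_mul_div]

theorem tendsto_expectedMyopic_div_expectedOPT (hφ0 : 0 < φ) (hφ1 : φ ≤ 1)
    (σ : ℕ → Solver Unit Unit) :
    Tendsto (fun T : ℕ => (example₁ φ T).expectedMyopic (σ T) / (example₁ φ T).expectedOPT)
      atTop (𝓝 φ) := by
  have hratio := (tendsto_floor_sqrt_mul_div_sqrt φ).div (tendsto_expectedOPT_div_sqrt hφ1)
    one_ne_zero
  rw [div_one] at hratio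
  refine hratio.congr' ?_
  filter_upwards [eventually_ge_atTop 1] with T hT
  rw [Pi.div_apply, expectedMyopic_eq hφ0]
  exact div_div_div_cancel_right₀ (Real.sqrt_pos.2 (by exact_mod_cast hT)).ne' _ _

theorem eventually_mul_expectedOPT_le_expectedOSO {ε : ℝ} (hε : 0 < ε) :
    ∀ᶠ T : ℕ in atTop, ∀ φ < 1, ∀ σ : Solver Unit Unit, σ.Equivariant →
      (1 - ε) * (example₁ φ T).expectedOPT ≤ (example₁ φ T).expectedOSO σ := by
  have hloss := (tendsto_one_sub_div_sqrt_sqrt 20).eventually_const_lt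
    (max_lt (sub_lt_self 1 hε) zero_lt_one)
  filter_upwards [eventually_ge_atTop 1, hloss] with T hT hfactor φ hφ σ hσ
  obtain ⟨hfactorε, hfactor0⟩ := max_lt_iff.1 hfactor
  calc (1 - ε) * (example₁ φ T).expectedOPT
      ≤ (1 - 20 / √√T) * (example₁ φ T).expectedOPT :=
        mul_le_mul_of_nonneg_right hfactorε.le (expectedOPT_nonneg φ T)
    _ ≤ (1 - 20 / √√T) * √T := mul_le_mul_of_nonneg_left (expectedOPT_le hφ.le T) hfactor0.le
    _ ≤ (example₁ φ T).expectedOSO σ := le_expectedOSO hφ hT hσ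

theorem eventually_expectedMyopic_pos_and_mul_le_expectedOSO {M : ℝ} (hφ0 : 0 < φ) (hφ1 : φ < 1)
    (hM : M * φ < 1) :
    ∀ᶠ T : ℕ in atTop, ∀ σ σ' : Solver Unit Unit, σ.Equivariant →
      0 < (example₁ φ T).expectedMyopic σ' ∧
        M * (example₁ φ T).expectedMyopic σ' ≤ (example₁ φ T).expectedOSO σ := by
  have hlt : ∀ᶠ T : ℕ in atTop,
      M * (⌊√(T : ℝ)⌋₊ * (1 * (1 / √T) + φ * (1 - 1 / √T)) / √T) < 1 - 20 / √√(T : ℝ) :=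
    ((tendsto_floor_sqrt_mul_div_sqrt φ).const_mul M).eventually_lt
      (tendsto_one_sub_div_sqrt_sqrt 20) hM
  filter_upwards [eventually_ge_atTop 1, hlt] with T hT hltT σ σ' hσ
  rw [← expectedMyopic_eq hφ0 T σ', ← mul_div_assoc,
    div_lt_iff₀ (Real.sqrt_pos.2 (by exact_mod_cast hT))] at hltT
  exact ⟨expectedMyopic_pos hφ0 hT σ', hltT.le.trans (le_expectedOSO hφ1 hT hσ)⟩

end Example
end OnlineAllocation

open OnlineAllocation in
theorem proposition1_general :
    (∀ M : ℝ, ∃ φ₀ : ℝ, 0 < φ₀ ∧ φ₀ ≤ 1 ∧ ∀ φ : ℝ, 0 < φ → φ < φ₀ → ∃ T₀ : ℕ, ∀ T : ℕ, T₀ ≤ T →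
      ∀ σ σ' : Solver Unit Unit, σ.Equivariant →
        0 < (example₁ φ T).expectedMyopic σ' ∧
        M * (example₁ φ T).expectedMyopic σ' ≤ (example₁ φ T).expectedOSO σ) ∧
    (∀ ε : ℝ, 0 < ε → ∃ T₀ : ℕ, ∀ T : ℕ, T₀ ≤ T → ∀ φ : ℝ, φ < 1 →
      ∀ σ : Solver Unit Unit, σ.Equivariant →
        (1 - ε) * (example₁ φ T).expectedOPT ≤ (example₁ φ T).expectedOSO σ) ∧
    (∀ φ : ℝ, φ ≤ 1 →
      Filter.Tendsto (fun T : ℕ => (example₁ φ T).expectedOPT / Real.sqrt T)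
        Filter.atTop (nhds 1)) ∧
    (∀ φ : ℝ, 0 < φ → ∀ T : ℕ, ∀ σ : Solver Unit Unit,
      (example₁ φ T).expectedMyopic σ =
        (Nat.floor (Real.sqrt T) : ℝ) *
          (1 * (1 / Real.sqrt T) + φ * (1 - 1 / Real.sqrt T))) ∧
    (∀ φ : ℝ, 0 < φ → φ ≤ 1 → ∀ σ : ℕ → Solver Unit Unit,
      Filter.Tendsto
        (fun T : ℕ => (example₁ φ T).expectedMyopic (σ T) / (example₁ φ T).expectedOPT)
        Filter.atTop (nhds φ)) := by
  refine ⟨fun M => ?_, fun ε hε => Filter.eventually_atTop.1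
    (eventually_mul_expectedOPT_le_expectedOSO hε), fun φ hφ => tendsto_expectedOPT_div_sqrt hφ,
    fun φ hφ T σ => expectedMyopic_eq hφ T σ,
    fun φ h0 h1 σ => tendsto_expectedMyopic_div_expectedOPT h0 h1 σ⟩
  have hM : 0 < |M| + 1 := by positivity
  have hφ₀ : 1 / (|M| + 1) ≤ 1 := (div_le_one hM).2 (by linarith [abs_nonneg M])
  refine ⟨1 / (|M| + 1), by positivity, hφ₀, fun φ h0 hφ => Filter.eventually_atTop.1
    (eventually_expectedMyopic_pos_and_mul_le_expectedOSO h0 (hφ.trans_le hφ₀) ?_)⟩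
  calc M * φ ≤ (|M| + 1) * φ := mul_le_mul_of_nonneg_right (by linarith [le_abs_self M]) h0.le
    _ < 1 := (lt_div_iff₀' hM).1 hφ

open OnlineAllocation in
/-- Single-sample OSO can do unboundedly better than the myopic policy. -/
theorem proposition1 :
    -- the ratio of the expected rewards of OSO and of the myopic policy is unbounded
    (∀ M : ℝ, ∃ φ₀ : ℝ, 0 < φ₀ ∧ φ₀ ≤ 1 ∧ ∀ φ : ℝ, 0 < φ → φ < φ₀ → ∃ T₀ : ℕ, ∀ T : ℕ, T₀ ≤ T →
      ∀ σ σ' : Solver Unit Unit, σ.Equivariant →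
        0 < (example₁ φ T).expectedMyopic σ' ∧
        M * (example₁ φ T).expectedMyopic σ' ≤ (example₁ φ T).expectedOSO σ) ∧
    -- OSO is within a factor `1 - ε` of the optimum
    (∀ ε : ℝ, 0 < ε → ∃ T₀ : ℕ, ∀ T : ℕ, T₀ ≤ T → ∀ φ : ℝ, 0 < φ → φ < 1 →
      ∀ σ : Solver Unit Unit, σ.Equivariant →
        (1 - ε) * (example₁ φ T).expectedOPT ≤ (example₁ φ T).expectedOSO σ) ∧
    -- the optimum is asymptotically `√T`
    (∀ φ : ℝ, 0 < φ → φ < 1 →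
      Filter.Tendsto (fun T : ℕ => (example₁ φ T).expectedOPT / Real.sqrt T)
        Filter.atTop (nhds 1)) ∧
    -- the exact value of the myopic policy
    (∀ φ : ℝ, 0 < φ → φ < 1 → ∀ T : ℕ, ∀ σ : Solver Unit Unit,
      (example₁ φ T).expectedMyopic σ =
        (Nat.floor (Real.sqrt T) : ℝ) *
          (1 * (1 / Real.sqrt T) + φ * (1 - 1 / Real.sqrt T))) ∧
    -- the myopic policy gets asymptotically the fraction `φ` of the optimum
    (∀ φ : ℝ, 0 < φ → φ < 1 → ∀ σ : ℕ → Solver Unit Unit,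
      Filter.Tendsto
        (fun T : ℕ => (example₁ φ T).expectedMyopic (σ T) / (example₁ φ T).expectedOPT)
        Filter.atTop (nhds φ)) := by
  obtain ⟨hratio, hOSO, hOPT, hmyopic, hlimit⟩ := proposition1_general
  exact ⟨hratio, fun ε hε => (hOSO ε hε).imp fun _ h T hT φ _ hφ => h T hT φ hφ,
    fun φ _ hφ => hOPT φ hφ.le, fun φ hφ _ => hmyopic φ hφ, fun φ h0 h1 => hlimit φ h0 h1.le⟩
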